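/- Let $n\in\{2,3\}$. A point of $\mathbb{Z}^n$ is primitive if the gcd of its coordinates is $1$; for primitive $v$, written as a column vector, put $q(v)=vv^t$, an element of the space of real symmetric $n\times n$ matrices. Let the Voronoi polyhedron $\Pi$ be the closed convex hull of all points $q(v)$ with $v\in\mathbb{Z}^n$ primitive. A Voronoi cone $\sigma$ is the closed cone $\{tx : t\ge 0,\ x\in F\}$ over a nonempty proper face $F$ of $\Pi$ (the intersection of $\Pi$ with a supporting hyperplane); it is top-dimensional if it spans the space of symmetric $n\times n$ matrices. Write $\operatorname{Vert}\sigma$ for the set of primitive points $v\in\mathbb{Z}^n$ such that $q(v)$ is a vertex of $F$. A modular symbol $\mathbf v=[v_1,\dots,v_n]$ is given by primitive points $v_1,\dots,v_n\in\mathbb{Z}^n$. Put $\|\mathbf v\|=|\det(v_1,\dots,v_n)|$ and $b(\mathbf v)=\sum_{i=1}^n v_iv_i^t$, and define the set of candidates $$\operatorname{Cand}\mathbf v=\Bigl\{w\in\mathbb{Z}^n \Bigm| w\ne 0 \text{ and } w=\sum_{i=1}^n q_iv_i \text{ with } q_i\in\mathbb{Q},\ 0\le |q_i|<1\Bigr\}.$$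 **Theorem.** Let $n=2$ or $n=3$. If $\mathbf v$ is a modular symbol with $\|\mathbf v\|>1$ and $\sigma$ is a top-dimensional Voronoi cone with $b(\mathbf v)\in\sigma$, then $$\operatorname{Cand}\mathbf v\cap\operatorname{Vert}\sigma\neq\varnothing .$$ -/

import Mathlib

namespace Voronoi

/-- The real vector space of symmetric `n × n` matrices, as a subspace of all matrices. -/
def symm (n : ℕ) : Submodule ℝ (Matrix (Fin n) (Fin n) ℝ) where
  carrier := {x | x.IsSymm}
  add_mem' := fun ha hb => ha.add hb
  zero_mem' := Matrix.isSymm_zero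
  smul_mem' := fun c _ hx => hx.smul c

/-- A point of `ℤⁿ` is primitive if the gcd of its coordinates is `1`. -/
def IsPrimitive {n : ℕ} (v : Fin n → ℤ) : Prop :=
  Finset.univ.gcd v = 1

/-- The rank-one quadratic form `q(v) = v vᵗ`, as a real symmetric matrix. -/
def q {n : ℕ} (v : Fin n → ℤ) : Matrix (Fin n) (Fin n) ℝ :=
  Matrix.of fun i j => (v i : ℝ) * (v j : ℝ)

/-- The Voronoi polyhedron: the closed convex hull of the points `q(v)`, `v` primitive. -/
def polyhedron (n : ℕ) : Set (Matrix (Fin n) (Fin n) ℝ) :=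
  closure (convexHull ℝ {x | ∃ v : Fin n → ℤ, IsPrimitive v ∧ x = q v})

/-- A Voronoi cone, given by the face of the Voronoi polyhedron that generates it: a nonempty
proper face, cut out by a supporting hyperplane. -/
structure Cone (n : ℕ) where
  /-- The face of the Voronoi polyhedron generating the cone. -/
  face : Set (Matrix (Fin n) (Fin n) ℝ)
  isExposed : IsExposed ℝ (polyhedron n) face
  nonempty : face.Nonempty
  proper : face ≠ polyhedron n

/-- The points of a Voronoi cone: the closed cone over the generating face. -/
def Cone.toSet {n : ℕ} (σ : Cone n) : Set (Matrix (Fin n) (Fin n) ℝ) :=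
  {y | ∃ t : ℝ, 0 ≤ t ∧ ∃ x ∈ σ.face, y = t • x}

/-- A Voronoi cone is top-dimensional if it spans the space of symmetric matrices. -/
def Cone.IsTop {n : ℕ} (σ : Cone n) : Prop :=
  Submodule.span ℝ σ.toSet = symm n

/-- The primitive points `v` such that `q(v)` is a vertex of the face generating the cone. -/
def Cone.vertices {n : ℕ} (σ : Cone n) : Set (Fin n → ℤ) :=
  {v | IsPrimitive v ∧ q v ∈ σ.face.extremePoints ℝ}

/-- A modular symbol `[v₁, …, vₙ]`, given by a tuple of primitive points. The notions `norm`, `b`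
and `cand` below do not change when the `vᵢ` are permuted or multiplied by signs. -/
structure ModularSymbol (n : ℕ) where
  /-- The points `v₁, …, vₙ`. -/
  vec : Fin n → Fin n → ℤ
  primitive : ∀ i, IsPrimitive (vec i)

/-- `‖v‖ = |det (v₁, …, vₙ)|`, the `vᵢ` being the columns. -/
def ModularSymbol.norm {n : ℕ} (v : ModularSymbol n) : ℤ :=
  |(Matrix.of fun i j => v.vec j i).det|

/-- `b(v) = ∑ vᵢ vᵢᵗ`. -/
def ModularSymbol.b {n : ℕ} (v : ModularSymbol n) : Matrix (Fin n) (Fin n) ℝ :=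
  ∑ i, q (v.vec i)

/-- The candidates of `v`: the nonzero integral points `w = ∑ cᵢ vᵢ` with `cᵢ` rational and
`0 ≤ |cᵢ| < 1`. -/
def ModularSymbol.cand {n : ℕ} (v : ModularSymbol n) : Set (Fin n → ℤ) :=
  {w | w ≠ 0 ∧ ∃ c : Fin n → ℚ, (∀ i, 0 ≤ |c i| ∧ |c i| < 1) ∧
    ∀ k, (w k : ℚ) = ∑ i, c i * (v.vec i k : ℚ)}

end Voronoi

namespace Voronoi

open Matrix MeasureTheory

/-! The face `F` of a top-dimensional cone is where some form `A ≥ 0` takes its minimum `m > 0` over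
Π, and every primitive `w` with `A(w) = m` gives a vertex. Minkowski's theorem bounds the
determinant: `m ^ n < 4 * det A` for `n ≤ 3`. Suppose that no such `w` is a candidate. Let `V` have
columns `vᵢ` and let `C = V⁻ᵀV⁻¹`, so that `C(w)` is the sum of the squared `v`-coordinates of `w`.
Some coordinate has absolute value at least `1`, so `C(w) ≥ 1` at the minimal vectors, hence `tr(Cx)
≥ 1` on `F`. Write `b(v) = t x` with `x ∈ F`. Since `b(v) = VVᵗ`, `tr(C b(v)) = n`, so `t ≤ n` and
`tr(VᵗAV) = tr(A b(v)) = t m ≤ n m`. By AM-GM, `det(V)² det A ≤ m ^ n`; as `det(V)² ≥ 4`, this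
contradicts the determinant bound. -/

/-- The real vector with the coordinates of an integral vector. -/
def realVec {n : ℕ} (w : Fin n → ℤ) : Fin n → ℝ := fun i => (w i : ℝ)

/-! ### Minkowski's bound and the AM-GM inequality. -/

theorem exists_transpose_mul_self {n : ℕ} {A : Matrix (Fin n) (Fin n) ℝ} (hA : A.PosSemidef) :
    ∃ B : Matrix (Fin n) (Fin n) ℝ, A = Bᵀ * B := by
  open scoped MatrixOrder in
  obtain ⟨B, hB⟩ := (CStarAlgebra.nonneg_iff_eq_star_mul_self (a := A)).1 hA.nonneg
  exact ⟨B, by rw [hB, star_eq_conjTranspose, conjTranspose_eq_transpose_of_trivial]⟩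

theorem dotProduct_transpose_mul_self {n : ℕ} (B : Matrix (Fin n) (Fin n) ℝ) (x : Fin n → ℝ) :
    x ⬝ᵥ (Bᵀ * B) *ᵥ x = ∑ i, (B *ᵥ x) i ^ 2 := by
  rw [← mulVec_mulVec, dotProduct_mulVec, vecMul_transpose]
  simp [dotProduct, sq]

theorem norm_toLp_lt_iff {n : ℕ} (x : Fin n → ℝ) {r : ℝ} (hr : 0 < r) :
    ‖WithLp.toLp 2 x‖ < r ↔ ∑ i, x i ^ 2 < r ^ 2 := by
  rw [EuclideanSpace.norm_eq, Real.sqrt_lt' hr]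
  simp

/-- Minkowski's theorem for the ellipsoid `‖B x‖ < r`. -/
theorem ofReal_volume_ball_le {n : ℕ} (B : Matrix (Fin n) (Fin n) ℝ) (hB : B.det ≠ 0) {r : ℝ}
    (hr : 0 < r) (h : ∀ w : Fin n → ℤ, w ≠ 0 → r ^ 2 ≤ ∑ i, (B *ᵥ realVec w) i ^ 2) :
    ENNReal.ofReal |B.det⁻¹| * volume (Metric.ball (0 : EuclideanSpace ℝ (Fin n)) r) ≤ 2 ^ n := by
  by_contra! hlt
  let s : Set (Fin n → ℝ) := (Matrix.toLin' B) ⁻¹'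
    (@WithLp.toLp 2 (Fin n → ℝ) ⁻¹' Metric.ball (0 : EuclideanSpace ℝ (Fin n)) r)
  have hvol : volume s =
      ENNReal.ofReal |B.det⁻¹| * volume (Metric.ball (0 : EuclideanSpace ℝ (Fin n)) r) := by
    rw [Measure.addHaar_preimage_linearMap _ (by rwa [LinearMap.det_toLin']),
      LinearMap.det_toLin',
      (PiLp.volume_preserving_toLp (Fin n)).measure_preimage measurableSet_ball.nullMeasurableSet]
  have hconv : Convex ℝ s := by
    have : s = ((WithLp.linearEquiv 2 ℝ (Fin n → ℝ)).symm.toLinearMap ∘ₗ Matrix.toLin' B) ⁻¹'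
      Metric.ball (0 : EuclideanSpace ℝ (Fin n)) r := rfl
    rw [this]
    exact (convex_ball _ _).linear_preimage _
  have hsymm : ∀ x ∈ s, -x ∈ s := by
    intro x hx
    simpa [s, mulVec_neg] using hx
  have : Countable (Submodule.span ℤ (Set.range (Pi.basisFun ℝ (Fin n)))).toAddSubgroup :=
    inferInstanceAs <| Countable (Submodule.span ℤ (Set.range (Pi.basisFun ℝ (Fin n))))
  obtain ⟨⟨x, hxL⟩, hx0, hxs⟩ := exists_ne_zero_mem_lattice_of_measure_mul_two_pow_lt_measure
    (ZSpan.isAddFundamentalDomain' (Pi.basisFun ℝ (Fin n)) volume) hsymm hconv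
    (by
      rw [hvol, ZSpan.volume_fundamentalDomain]
      have : (Matrix.of (Pi.basisFun ℝ (Fin n))) = 1 := by
        ext i j; simp [Matrix.one_apply, Pi.single_apply, eq_comm]
      simpa [this] using hlt)
  obtain ⟨c, hc⟩ := (Submodule.mem_span_range_iff_exists_fun ℤ).1 hxL
  have hxc : x = realVec c := by
    rw [← hc]; ext i; simp [realVec, Finset.sum_apply, Pi.single_apply]
  have hc0 : c ≠ 0 := by
    rintro rfl
    apply hx0
    ext i
    simp [hxc, realVec]
  have h1 : ∑ i, (B *ᵥ realVec c) i ^ 2 < r ^ 2 := by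
    rw [← norm_toLp_lt_iff _ hr, ← hxc]
    simpa [s] using hxs
  exact (h c hc0).not_gt h1

/-- The constant is the one that Minkowski's theorem gives for `n = 3`, where the ball has volume
`4πr³/3`. For `n = 2` it gives the stronger `π² / 16`. -/
theorem pow_mul_le_det_of_posDef {n : ℕ} (hn : n = 2 ∨ n = 3) {A : Matrix (Fin n) (Fin n) ℝ}
    (hA : A.PosDef) {m : ℝ} (hm : 0 < m)
    (h : ∀ w : Fin n → ℤ, w ≠ 0 → m ≤ realVec w ⬝ᵥ A *ᵥ realVec w) :
    m ^ n * (Real.pi ^ 2 / 36) ≤ A.det := by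
  obtain ⟨B, rfl⟩ := exists_transpose_mul_self hA.posSemidef
  have hdet := hA.det_pos
  rw [det_mul, det_transpose] at hdet ⊢
  have hB : B.det ≠ 0 := by rintro h; simp [h] at hdet
  have hr : 0 < √m := Real.sqrt_pos.2 hm
  have hrm : √m ^ 2 = m := Real.sq_sqrt hm.le
  have key := ofReal_volume_ball_le B hB hr fun w hw => by
    rw [hrm, ← dotProduct_transpose_mul_self]; exact h w hw
  rw [← abs_mul_abs_self B.det]
  have hd : 0 < |B.det| := abs_pos.2 hB
  have hpi := Real.pi_pos
  rw [abs_inv] at key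
  generalize |B.det| = d at *
  have key' := ENNReal.toReal_mono (by simp) key
  rw [← hrm]
  rcases hn with rfl | rfl
  · simp only [EuclideanSpace.volume_ball_fin_two, ENNReal.toReal_mul, ENNReal.toReal_pow,
      ENNReal.toReal_ofReal (inv_pos.2 hd).le, ENNReal.toReal_ofReal hr.le,
      ENNReal.toReal_ofReal hpi.le, ENNReal.toReal_ofNat, inv_mul_le_iff₀ hd] at key'
    have := pow_le_pow_left₀ (by positivity) key' 2
    nlinarith [sq_nonneg d]
  · simp only [EuclideanSpace.volume_ball_fin_three, ENNReal.toReal_mul, ENNReal.toReal_pow,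
      ENNReal.toReal_ofReal (inv_pos.2 hd).le, ENNReal.toReal_ofReal hr.le,
      ENNReal.toReal_ofReal (by positivity : 0 ≤ Real.pi * 4 / 3), ENNReal.toReal_ofNat,
      inv_mul_le_iff₀ hd] at key'
    have := pow_le_pow_left₀ (by positivity) key' 2
    linarith

/-- Perturbing `A` to `A + ε` keeps the lower bound `m`, and the determinant is continuous.
Definiteness of `A` then becomes a consequence of the bound. -/
theorem pow_mul_le_det {n : ℕ} (hn : n = 2 ∨ n = 3) {A : Matrix (Fin n) (Fin n) ℝ}
    (hA : A.PosSemidef) {m : ℝ} (hm : 0 < m)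
    (h : ∀ w : Fin n → ℤ, w ≠ 0 → m ≤ realVec w ⬝ᵥ A *ᵥ realVec w) :
    m ^ n * (Real.pi ^ 2 / 36) ≤ A.det := by
  have hcont : Continuous fun ε : ℝ => (A + ε • (1 : Matrix (Fin n) (Fin n) ℝ)).det := by
    fun_prop
  have hlim := (hcont.tendsto 0).mono_left (nhdsWithin_le_nhds (s := Set.Ioi 0))
  simp only [zero_smul, add_zero] at hlim
  refine ge_of_tendsto hlim ?_
  filter_upwards [self_mem_nhdsWithin] with ε hε
  refine pow_mul_le_det_of_posDef hn (PosDef.posSemidef_add hA (PosDef.one.smul hε)) hm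
    fun w hw => (h w hw).trans ?_
  rw [add_mulVec, dotProduct_add, smul_mulVec, one_mulVec, dotProduct_smul]
  have : 0 ≤ realVec w ⬝ᵥ realVec w := by
    simpa using dotProduct_star_self_nonneg (realVec w)
  have := mul_nonneg (le_of_lt hε) this
  simpa using this

/-- AM-GM for the eigenvalues. -/
theorem pow_card_mul_det_le_trace_pow {n : ℕ} (hn : n = 2 ∨ n = 3) {P : Matrix (Fin n) (Fin n) ℝ}
    (hP : P.PosSemidef) : (n : ℝ) ^ n * P.det ≤ P.trace ^ n := by
  rw [hP.1.det_eq_prod_eigenvalues, hP.1.trace_eq_sum_eigenvalues]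
  have h0 := hP.eigenvalues_nonneg
  generalize hP.1.eigenvalues = f at *
  rcases hn with rfl | rfl
  · simp only [Fin.prod_univ_two, Fin.sum_univ_two, RCLike.ofReal_real_eq_id, id]
    push_cast
    nlinarith [sq_nonneg (f 0 - f 1)]
  · simp only [Fin.prod_univ_three, Fin.sum_univ_three, RCLike.ofReal_real_eq_id, id]
    have hx := h0 0
    have hy := h0 1
    have hz := h0 2
    push_cast
    nlinarith [mul_nonneg hx (sq_nonneg (f 1 - f 2)), mul_nonneg hy (sq_nonneg (f 0 - f 2)),
      mul_nonneg hz (sq_nonneg (f 0 - f 1)), mul_nonneg hx (sq_nonneg (f 0 - f 1)),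
      mul_nonneg hx (sq_nonneg (f 0 - f 2)), mul_nonneg hy (sq_nonneg (f 0 - f 1)),
      mul_nonneg hy (sq_nonneg (f 1 - f 2)), mul_nonneg hz (sq_nonneg (f 0 - f 2)),
      mul_nonneg hz (sq_nonneg (f 1 - f 2))]

/-! ### The trace pairing on the Voronoi polyhedron. -/

theorem trace_mul_vecMulVec_self {n : ℕ} (A : Matrix (Fin n) (Fin n) ℝ) (y : Fin n → ℝ) :
    (A * vecMulVec y y).trace = y ⬝ᵥ A *ᵥ y := by
  rw [mul_vecMulVec, trace_vecMulVec, dotProduct_comm]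

theorem q_eq_vecMulVec {n : ℕ} (w : Fin n → ℤ) : q w = vecMulVec (realVec w) (realVec w) := rfl

theorem trace_mul_q {n : ℕ} (A : Matrix (Fin n) (Fin n) ℝ) (w : Fin n → ℤ) :
    (A * q w).trace = realVec w ⬝ᵥ A *ᵥ realVec w :=
  trace_mul_vecMulVec_self A _

theorem q_mem_symm {n : ℕ} (w : Fin n → ℤ) : q w ∈ symm n :=
  Matrix.IsSymm.ext fun _ _ => mul_comm _ _

theorem q_mem_polyhedron {n : ℕ} {w : Fin n → ℤ} (hw : IsPrimitive w) : q w ∈ polyhedron n :=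
  subset_closure (subset_convexHull ℝ _ ⟨w, hw, rfl⟩)

theorem polyhedron_subset {n : ℕ} {S : Set (Matrix (Fin n) (Fin n) ℝ)} (hc : Convex ℝ S)
    (hcl : IsClosed S) (h : ∀ w : Fin n → ℤ, IsPrimitive w → q w ∈ S) : polyhedron n ⊆ S :=
  closure_minimal (convexHull_min (by rintro _ ⟨w, hw, rfl⟩; exact h w hw) hc) hcl

theorem polyhedron_subset_symm {n : ℕ} : polyhedron n ⊆ symm n :=
  polyhedron_subset (symm n).convex (symm n).closed_of_finiteDimensional fun w _ => q_mem_symm w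

theorem le_trace_mul_of_mem_polyhedron {n : ℕ} {A : Matrix (Fin n) (Fin n) ℝ} {c : ℝ}
    (h : ∀ w : Fin n → ℤ, IsPrimitive w → c ≤ realVec w ⬝ᵥ A *ᵥ realVec w)
    {x : Matrix (Fin n) (Fin n) ℝ} (hx : x ∈ polyhedron n) : c ≤ (A * x).trace := by
  have hlin : IsLinearMap ℝ fun x : Matrix (Fin n) (Fin n) ℝ => (A * x).trace :=
    ⟨fun x y => by simp [mul_add], fun r x => by simp⟩
  refine polyhedron_subset (S := {x | c ≤ (A * x).trace}) (convex_halfSpace_ge hlin c)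
    (isClosed_le (g := fun x => (A * x).trace) continuous_const (by fun_prop)) (fun w hw => ?_) hx
  rw [Set.mem_ofPred_eq, trace_mul_q]
  exact h w hw

theorem posSemidef_of_mem_polyhedron {n : ℕ} {x : Matrix (Fin n) (Fin n) ℝ}
    (hx : x ∈ polyhedron n) : x.PosSemidef := by
  refine PosSemidef.of_dotProduct_mulVec_nonneg ?_ fun y => ?_
  · rw [IsHermitian, conjTranspose_eq_transpose_of_trivial]
    exact polyhedron_subset_symm hx
  · rw [star_trivial, ← trace_mul_vecMulVec_self, trace_mul_comm]
    refine le_trace_mul_of_mem_polyhedron (fun w _ => ?_) hx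
    rw [vecMulVec_mulVec, dotProduct_smul, dotProduct_comm]
    exact mul_self_nonneg _

/-! ### Forms bounded below on primitive vectors. -/

/-- On symmetric matrices, a linear functional is the trace pairing with a symmetric matrix. -/
theorem exists_isSymm_forall_eq_trace {n : ℕ} (l : Matrix (Fin n) (Fin n) ℝ →ₗ[ℝ] ℝ) :
    ∃ A : Matrix (Fin n) (Fin n) ℝ, A.IsSymm ∧ ∀ x ∈ symm n, l x = (A * x).trace := by
  refine ⟨Matrix.of fun i j => (l (single i j 1) + l (single j i 1)) / 2,
    Matrix.IsSymm.ext fun i j => by simp [add_comm], fun x hx => ?_⟩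
  have hl : ∀ x : Matrix (Fin n) (Fin n) ℝ, l x = ∑ i, ∑ j, x i j * l (single i j 1) := by
    intro x
    conv_lhs => rw [matrix_eq_sum_single x]
    simp only [map_sum]
    refine Finset.sum_congr rfl fun i _ => Finset.sum_congr rfl fun j _ => ?_
    rw [← smul_eq_mul, ← map_smul, smul_single, smul_eq_mul, mul_one]
  have hl' : l x = ∑ i, ∑ j, x i j * l (single j i 1) := by
    rw [hl, Finset.sum_comm]
    refine Finset.sum_congr rfl fun i _ => Finset.sum_congr rfl fun j _ => ?_
    rw [Matrix.IsSymm.apply (show x.IsSymm from hx)]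
  have : l x = (l x + l x) / 2 := by ring
  rw [this]
  nth_rewrite 1 [hl x]
  rw [hl']
  simp only [trace, diag, mul_apply, of_apply, ← Finset.sum_add_distrib, Finset.sum_div]
  refine Finset.sum_congr rfl fun i _ => Finset.sum_congr rfl fun j _ => ?_
  rw [Matrix.IsSymm.apply (show x.IsSymm from hx)]
  ring

theorem isPrimitive_smul_add_single {n : ℕ} (w : Fin n → ℤ) {i j : Fin n} (hij : j ≠ i) (k : ℤ) :
    IsPrimitive ((k * w i) • w + Pi.single j 1) := by
  rw [IsPrimitive, ← Finset.normalize_gcd, normalize_eq_one]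
  -- Coordinate `i` is `k * w i * w i` and coordinate `j` is `k * w i * w j + 1`; they are coprime.
  have h : IsCoprime (k * w i) (k * w i * w j + 1) := ⟨-w j, 1, by ring⟩
  have h' : IsCoprime (w i) (k * w i * w j + 1) := ⟨-(k * w j), 1, by ring⟩

  refine (h.mul_left h').isUnit_of_dvd' ?_ ?_
  · have := Finset.gcd_dvd (f := (k * w i) • w + Pi.single j 1) (Finset.mem_univ i)
    rwa [Pi.add_apply, Pi.single_eq_of_ne hij.symm, add_zero, Pi.smul_apply, smul_eq_mul] at this
  · have := Finset.gcd_dvd (f := (k * w i) • w + Pi.single j 1) (Finset.mem_univ j)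
    rwa [Pi.add_apply, Pi.single_eq_same, Pi.smul_apply, smul_eq_mul] at this

/-- If `A(w) < 0`, the primitive vectors `k wᵢ w + eⱼ` make `A` a quadratic polynomial in `k` with
negative leading coefficient, hence unbounded below. A second index `j` requires `n ≥ 2`. -/
theorem nonneg_of_bddBelow_primitive {n : ℕ} (hn : 2 ≤ n) {A : Matrix (Fin n) (Fin n) ℝ} {m : ℝ}
    (h : ∀ w : Fin n → ℤ, IsPrimitive w → m ≤ realVec w ⬝ᵥ A *ᵥ realVec w) (w : Fin n → ℤ) :
    0 ≤ realVec w ⬝ᵥ A *ᵥ realVec w := by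
  by_contra! hneg
  obtain ⟨i, hi⟩ : ∃ i, w i ≠ 0 := by
    by_contra! h0
    have : realVec w = 0 := by ext i; simp [realVec, h0]
    simp [this] at hneg
  have : Nontrivial (Fin n) := Fin.nontrivial_iff_two_le.2 hn
  obtain ⟨j, hij⟩ := exists_ne i
  set e : Fin n → ℝ := Pi.single j 1
  set x := realVec w
  have hx : ∀ k : ℤ, realVec ((k * w i) • w + Pi.single j 1) = ((k : ℝ) * w i) • x + e := by
    intro k
    ext l
    by_cases hl : l = j
    · subst hl; simp [realVec, x, e]
    · simp [realVec, x, e, hl]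
  set a := (w i : ℝ) ^ 2 * (x ⬝ᵥ A *ᵥ x)
  set b := (w i : ℝ) * (x ⬝ᵥ A *ᵥ e + e ⬝ᵥ A *ᵥ x)
  set c := e ⬝ᵥ A *ᵥ e
  have ha : a < 0 := mul_neg_of_pos_of_neg (by positivity) hneg
  have hk : ∀ k : ℕ, m ≤ a * k ^ 2 + b * k + c := by
    intro k
    have := h _ (isPrimitive_smul_add_single w hij k)
    rw [hx] at this
    simp only [mulVec_add, mulVec_smul, dotProduct_add, add_dotProduct, smul_dotProduct,
      dotProduct_smul, smul_eq_mul, Int.cast_natCast] at this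
    linarith
  obtain ⟨k, hk'⟩ := exists_nat_gt ((|b| + |c| + |m|) / -a)
  rw [div_lt_iff₀ (by linarith)] at hk'
  have h1 := hk (k + 1)
  push_cast at h1
  have hk0 : (0 : ℝ) ≤ k := Nat.cast_nonneg k
  have h2 : a * (k + 1) < -(|b| + |c| + |m|) := by nlinarith
  have h3 := mul_lt_mul_of_pos_right h2 (by linarith : (0 : ℝ) < k + 1)
  nlinarith [le_abs_self b, le_abs_self c, neg_abs_le m, abs_nonneg c, abs_nonneg m,
    mul_le_mul_of_nonneg_right (le_abs_self b) (by linarith : (0 : ℝ) ≤ k + 1),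
    mul_nonneg (abs_nonneg c) hk0, mul_nonneg (abs_nonneg m) hk0]

/-- Clear denominators, then use the density of `ℚⁿ` in `ℝⁿ`. -/
theorem nonneg_of_nonneg_int {n : ℕ} {A : Matrix (Fin n) (Fin n) ℝ}
    (h : ∀ w : Fin n → ℤ, 0 ≤ realVec w ⬝ᵥ A *ᵥ realVec w) (x : Fin n → ℝ) :
    0 ≤ x ⬝ᵥ A *ᵥ x := by
  have hd : DenseRange (Pi.map fun (_ : Fin n) (r : ℚ) => (r : ℝ)) :=
    DenseRange.piMap fun _ => Rat.denseRange_cast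
  refine isClosed_property hd (p := fun x => 0 ≤ x ⬝ᵥ A *ᵥ x)
    (isClosed_le continuous_const (by fun_prop)) (fun r => ?_) x
  obtain ⟨d, hd⟩ := IsLocalization.exist_integer_multiples_of_finite (nonZeroDivisors ℤ) r
  choose w hw using hd
  have hd0 : ((d : ℤ) : ℝ) ≠ 0 := Int.cast_ne_zero.2 (nonZeroDivisors.coe_ne_zero d)
  have : realVec w = ((d : ℤ) : ℝ) • Pi.map (fun (_ : Fin n) (r : ℚ) => (r : ℝ)) r := by
    ext i
    have := congrArg (Rat.cast : ℚ → ℝ) (hw i)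
    simpa [realVec, zsmul_eq_mul] using this
  have h1 := h w
  rw [this, mulVec_smul, dotProduct_smul, smul_dotProduct, smul_smul, smul_eq_mul] at h1
  exact nonneg_of_mul_nonneg_right h1 (mul_self_pos.2 hd0)

theorem le_of_forall_primitive_le {n : ℕ} {A : Matrix (Fin n) (Fin n) ℝ} {m : ℝ} (hm : 0 ≤ m)
    (h : ∀ w : Fin n → ℤ, IsPrimitive w → m ≤ realVec w ⬝ᵥ A *ᵥ realVec w) {w : Fin n → ℤ}
    (hw : w ≠ 0) : m ≤ realVec w ⬝ᵥ A *ᵥ realVec w := by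
  obtain ⟨i, hi⟩ := Function.ne_iff.1 hw
  obtain ⟨u, hu, hu1⟩ := Finset.extract_gcd w ⟨i, Finset.mem_univ i⟩
  set g := Finset.univ.gcd w
  have hg : g ≠ 0 := by
    intro hg
    exact hi (by simpa [hg] using hu i (Finset.mem_univ i))
  have hwu : realVec w = (g : ℝ) • realVec u := by
    ext l
    have := congrArg (Int.cast : ℤ → ℝ) (hu l (Finset.mem_univ l))
    simpa [realVec] using this
  have hg1 : (1 : ℝ) ≤ g * g := by
    exact_mod_cast Int.add_one_le_iff.2 (mul_self_pos.2 hg)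
  rw [hwu, mulVec_smul, dotProduct_smul, smul_dotProduct, smul_smul, smul_eq_mul]
  nlinarith [h u hu1]

theorem finite_setOf_le {n : ℕ} {A : Matrix (Fin n) (Fin n) ℝ} (hA : A.PosDef) (R : ℝ) :
    {w : Fin n → ℤ | realVec w ⬝ᵥ A *ᵥ realVec w ≤ R}.Finite := by
  obtain ⟨B, rfl⟩ := exists_transpose_mul_self hA.posSemidef
  have hB : IsUnit B.det := by
    have := hA.det_pos
    rw [det_mul] at this
    exact isUnit_iff_ne_zero.2 fun h => by simp [h] at this
  let N : Fin n → ℤ := fun i => ⌈∑ j, |B⁻¹ i j| * √R⌉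
  refine (Set.finite_Icc (-N) N).subset fun w hw => ?_
  rw [Set.mem_ofPred_eq, dotProduct_transpose_mul_self] at hw
  have hy : ∀ j, |(B *ᵥ realVec w) j| ≤ √R := fun j => Real.abs_le_sqrt <|
    (Finset.single_le_sum (f := fun i => (B *ᵥ realVec w) i ^ 2) (fun i _ => sq_nonneg _)
      (Finset.mem_univ j)).trans hw
  have hwi : ∀ i, |w i| ≤ N i := by
    intro i
    have : (w i : ℝ) = (B⁻¹ *ᵥ (B *ᵥ realVec w)) i := by
      rw [mulVec_mulVec, nonsing_inv_mul _ hB, one_mulVec]; rfl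
    have h2 : |(w i : ℝ)| ≤ ∑ j, |B⁻¹ i j| * √R := by
      rw [this]
      change |∑ j, B⁻¹ i j * (B *ᵥ realVec w) j| ≤ _
      refine (Finset.abs_sum_le_sum_abs _ _).trans (Finset.sum_le_sum fun j _ => ?_)
      rw [abs_mul]
      exact mul_le_mul_of_nonneg_left (hy j) (abs_nonneg _)
    have h3 : |(w i : ℝ)| ≤ N i := h2.trans (Int.le_ceil _)
    exact_mod_cast h3
  exact ⟨fun i => (abs_le.1 (hwi i)).1, fun i => (abs_le.1 (hwi i)).2⟩

/-! ### Minimal vectors give vertices. -/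

/-- A rank-one form dominates only its own multiples among positive semidefinite forms. -/
theorem exists_eq_smul_vecMulVec {n : ℕ} {x : Matrix (Fin n) (Fin n) ℝ} (hx : x.PosSemidef)
    {v : Fin n → ℝ} (hv : v ≠ 0) (h : ∀ u, u ⬝ᵥ v = 0 → u ⬝ᵥ x *ᵥ u = 0) :
    ∃ s : ℝ, x = s • vecMulVec v v := by
  have hN : v ⬝ᵥ v ≠ 0 := fun h => hv (dotProduct_self_eq_zero.1 h)
  have hker : ∀ z, x *ᵥ z = (z ⬝ᵥ v / (v ⬝ᵥ v)) • x *ᵥ v := by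
    intro z
    rw [← sub_eq_zero, ← mulVec_smul, ← mulVec_sub]
    -- A semidefinite form vanishes at a vector only if the vector is in its kernel; here it is the
    -- component of `z` orthogonal to `v`.
    refine (hx.dotProduct_mulVec_zero_iff _).1 ?_
    rw [star_trivial]
    refine h _ ?_
    rw [sub_dotProduct, smul_dotProduct, smul_eq_mul, div_mul_cancel₀ _ hN, sub_self]
  have hcol : ∀ i j, x i j = v j / (v ⬝ᵥ v) * (x *ᵥ v) i := by
    intro i j
    have := congrFun (hker (Pi.single j 1)) i
    simpa using this
  have hsymm : ∀ i j, x i j = x j i := fun i j => by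
    simpa using (hx.1.apply i j).symm
  have hxv : ∀ i, (x *ᵥ v) i = v i / (v ⬝ᵥ v) * (v ⬝ᵥ x *ᵥ v) := by
    intro i
    simp only [mulVec, dotProduct] at hcol ⊢
    rw [Finset.mul_sum]
    refine Finset.sum_congr rfl fun j _ => ?_
    rw [hsymm i j, hcol j i]
    ring
  refine ⟨(v ⬝ᵥ x *ᵥ v) / (v ⬝ᵥ v) ^ 2, ?_⟩
  ext i j
  rw [hcol, hxv, Matrix.smul_apply, vecMulVec_apply, smul_eq_mul]
  field_simp

/-- In a segment through `q w`, both endpoints are semidefinite, so they vanish on the complement of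
`w` and are multiples of `q w`. The value `m ≠ 0` fixes the multiple. -/
theorem q_mem_extremePoints {n : ℕ} {F : Set (Matrix (Fin n) (Fin n) ℝ)} (hF : F ⊆ polyhedron n)
    {A : Matrix (Fin n) (Fin n) ℝ} {m : ℝ} (hm : m ≠ 0) (hFm : ∀ x ∈ F, (A * x).trace = m)
    {w : Fin n → ℤ} (hw : q w ∈ F) : q w ∈ F.extremePoints ℝ := by
  have hw0 : realVec w ≠ 0 := by
    intro h
    have := hFm _ hw
    rw [trace_mul_q, h, zero_dotProduct] at this
    exact hm this.symm
  rw [mem_extremePoints]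
  have key : ∀ x ∈ F, ∀ y ∈ F, q w ∈ openSegment ℝ x y → x = q w := by
    rintro x hx y hy ⟨a, b, ha, hb, -, hab⟩
    have hxp := posSemidef_of_mem_polyhedron (hF hx)
    have hyp := posSemidef_of_mem_polyhedron (hF hy)
    obtain ⟨s, hs⟩ := exists_eq_smul_vecMulVec hxp hw0 fun u hu => by
      have h1 := congrArg (fun M : Matrix (Fin n) (Fin n) ℝ => u ⬝ᵥ M *ᵥ u) hab
      simp only [q_eq_vecMulVec, vecMulVec_mulVec, add_mulVec, smul_mulVec, dotProduct_add,
        dotProduct_smul, hu, smul_zero, smul_eq_mul] at h1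
      have h2 : 0 ≤ u ⬝ᵥ x *ᵥ u := by simpa using hxp.dotProduct_mulVec_nonneg u
      have h3 : 0 ≤ u ⬝ᵥ y *ᵥ u := by simpa using hyp.dotProduct_mulVec_nonneg u
      have h4 := mul_nonneg hb.le h3
      nlinarith
    have h5 := hFm _ hx
    rw [hs, ← q_eq_vecMulVec, Matrix.mul_smul, trace_smul, hFm _ hw, smul_eq_mul] at h5
    have h6 : s = 1 := mul_right_cancel₀ hm (by rw [h5, one_mul])
    rw [hs, h6, one_smul, q_eq_vecMulVec]
  refine ⟨hw, fun x hx y hy h => ⟨key x hx y hy h, key y hy x hx ?_⟩⟩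
  rwa [openSegment_symm]

/-! ### The form attached to a top-dimensional cone. -/

/-- The face generating a top-dimensional Voronoi cone consists of the minimal points of a
positive semidefinite form with positive minimum. -/
theorem Cone.IsTop.exists_form {n : ℕ} (hn : 2 ≤ n) {σ : Cone n} (hσ : σ.IsTop) :
    ∃ (A : Matrix (Fin n) (Fin n) ℝ) (m : ℝ), A.PosSemidef ∧ 0 < m ∧
      (∀ w : Fin n → ℤ, IsPrimitive w → m ≤ realVec w ⬝ᵥ A *ᵥ realVec w) ∧
      σ.face = {x | x ∈ polyhedron n ∧ (A * x).trace = m} := by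
  obtain ⟨l, hl⟩ := σ.isExposed σ.nonempty
  obtain ⟨x₀, hx₀⟩ := σ.nonempty
  obtain ⟨A, hA, hAl⟩ := exists_isSymm_forall_eq_trace (-l.toLinearMap)
  have hlA : ∀ x ∈ polyhedron n, l x = -(A * x).trace := fun x hx => by
    rw [← hAl x (polyhedron_subset_symm hx)]
    simp
  have hx₀' := hx₀
  rw [hl] at hx₀'
  obtain ⟨hx₀P, hmax⟩ := hx₀'
  set m := (A * x₀).trace
  have hmin : ∀ y ∈ polyhedron n, m ≤ (A * y).trace := fun y hy => by
    have := hmax y hy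
    rw [hlA y hy, hlA x₀ hx₀P] at this
    linarith
  have hface : σ.face = {x | x ∈ polyhedron n ∧ (A * x).trace = m} := by
    rw [hl]
    ext x
    refine and_congr_right fun hx => ⟨fun h => ?_, fun h y hy => ?_⟩
    · have := h x₀ hx₀P
      rw [hlA x hx, hlA x₀ hx₀P] at this
      linarith [hmin x hx]
    · rw [hlA x hx, hlA y hy, h]
      linarith [hmin y hy]
  have hprim : ∀ w : Fin n → ℤ, IsPrimitive w → m ≤ realVec w ⬝ᵥ A *ᵥ realVec w := fun w hw => by
    rw [← trace_mul_q]
    exact hmin _ (q_mem_polyhedron hw)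
  have hint := nonneg_of_bddBelow_primitive hn hprim
  have hpsd : A.PosSemidef := by
    refine PosSemidef.of_dotProduct_mulVec_nonneg ?_ fun y => ?_
    · rwa [IsHermitian, conjTranspose_eq_transpose_of_trivial]
    · rw [star_trivial]
      exact nonneg_of_nonneg_int hint y
  refine ⟨A, m, hpsd, ?_, hprim, hface⟩
  have hm0 : 0 ≤ m := le_trace_mul_of_mem_polyhedron (fun w _ => hint w) hx₀P
  refine hm0.lt_of_ne' fun hm => σ.proper ?_
  -- If `m = 0`, the pairing with `A` vanishes on the cone, hence on all symmetric matrices, and the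
  -- face is not proper.
  have hspan : symm n ≤ LinearMap.ker (traceLinearMap (Fin n) ℝ ℝ ∘ₗ LinearMap.mulLeft ℝ A) := by
    rw [← hσ, Submodule.span_le]
    rintro _ ⟨t, -, x, hx, rfl⟩
    rw [hface] at hx
    simp [hx.2, hm]
  rw [hface]
  ext x
  refine and_iff_left_of_imp fun hx => ?_
  rw [hm]
  simpa using hspan (polyhedron_subset_symm hx)

/-- If a form is positive definite with minimum `m`, a form that is nonnegative everywhere and at
least one at the minimal points is at least one on the face of minimal points. -/
theorem one_le_trace_mul_of_mem_face {n : ℕ} {A : Matrix (Fin n) (Fin n) ℝ} (hA : A.PosDef) {m : ℝ}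
    (hm : ∀ w : Fin n → ℤ, IsPrimitive w → m ≤ realVec w ⬝ᵥ A *ᵥ realVec w)
    {C : Matrix (Fin n) (Fin n) ℝ} (hC : C.PosSemidef)
    (h : ∀ w : Fin n → ℤ, IsPrimitive w → realVec w ⬝ᵥ A *ᵥ realVec w = m →
      1 ≤ realVec w ⬝ᵥ C *ᵥ realVec w)
    {x : Matrix (Fin n) (Fin n) ℝ} (hx : x ∈ polyhedron n) (hxm : (A * x).trace = m) :
    1 ≤ (C * x).trace := by
  -- Because Π is a closure, `F` is not described as a hull of minimal points. Instead `C + L A ≥ 1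
  -- + L m` is shown at every primitive point for large `L`: finitely many have `A(w) ≤ m + 1`, and
  -- `L ≥ 1` handles the others.
  obtain ⟨K, hK⟩ := ((finite_setOf_le hA (m + 1)).image
    fun w => (realVec w ⬝ᵥ A *ᵥ realVec w - m)⁻¹).bddAbove
  set L := max K 1
  have hL : 0 < L := lt_max_of_lt_right one_pos
  have key : 1 + L * m ≤ ((C + L • A) * x).trace := by
    refine le_trace_mul_of_mem_polyhedron (fun w hw => ?_) hx
    rw [add_mulVec, smul_mulVec, dotProduct_add, dotProduct_smul, smul_eq_mul]
    have hC0 : 0 ≤ realVec w ⬝ᵥ C *ᵥ realVec w := by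
      simpa using hC.dotProduct_mulVec_nonneg (realVec w)
    rcases (hm w hw).eq_or_lt with heq | hlt
    · have := h w hw heq.symm
      rw [← heq]
      linarith
    · have hpos : 0 < realVec w ⬝ᵥ A *ᵥ realVec w - m := sub_pos.2 hlt
      have : 1 ≤ L * (realVec w ⬝ᵥ A *ᵥ realVec w - m) := by
        rcases le_or_gt (realVec w ⬝ᵥ A *ᵥ realVec w) (m + 1) with hle | hgt
        · have h1 := (hK ⟨w, hle, rfl⟩).trans (le_max_left K 1)
          rwa [inv_le_iff_one_le_mul₀ hpos] at h1
        · nlinarith [le_max_right K 1]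
      linarith
  rw [add_mul, trace_add, smul_mul, trace_smul, hxm, smul_eq_mul] at key
  linarith

/-! ### Coordinates with respect to a modular symbol. -/

theorem ModularSymbol.b_eq {n : ℕ} (v : ModularSymbol n) :
    v.b = (Matrix.of fun i j => (v.vec j i : ℝ)) * (Matrix.of fun i j => (v.vec j i : ℝ))ᵀ := by
  ext i j
  simp [ModularSymbol.b, Matrix.sum_apply, q, mul_apply]

theorem ModularSymbol.four_le_det_sq {n : ℕ} {v : ModularSymbol n} (hv : 1 < v.norm) :
    4 ≤ (Matrix.of fun i j => (v.vec j i : ℝ)).det ^ 2 := by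
  have h1 : (Matrix.of fun i j => (v.vec j i : ℝ)).det =
      ((Matrix.of fun i j => v.vec j i).det : ℝ) := by
    rw [Int.cast_det]
    rfl
  rw [h1, ← sq_abs]
  have h2 : (2 : ℝ) ≤ |((Matrix.of fun i j => v.vec j i).det : ℝ)| := by exact_mod_cast hv
  nlinarith

/-- The coordinates with respect to `v` of a nonzero integral point that is not a candidate have
sum of squares at least one. -/
theorem ModularSymbol.one_le_of_notMem_cand {n : ℕ} {v : ModularSymbol n} (hv : 1 < v.norm)
    {w : Fin n → ℤ} (hw : w ≠ 0) (hc : w ∉ v.cand) :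
    1 ≤ ∑ i, ((Matrix.of fun i j => (v.vec j i : ℝ))⁻¹ *ᵥ realVec w) i ^ 2 := by
  set V : Matrix (Fin n) (Fin n) ℝ := Matrix.of fun i j => (v.vec j i : ℝ)
  let VQ : Matrix (Fin n) (Fin n) ℚ := Matrix.of fun i j => (v.vec j i : ℚ)
  have hV : IsUnit V.det := isUnit_iff_ne_zero.2 fun h => by
    have := four_le_det_sq hv
    rw [h] at this
    norm_num at this
  have hVQ : IsUnit VQ.det := isUnit_iff_ne_zero.2 fun h => by
    have h1 : VQ.det = ((Matrix.of fun i j => v.vec j i).det : ℚ) := by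
      rw [Int.cast_det]
      rfl
    rw [h1, Int.cast_eq_zero] at h
    rw [ModularSymbol.norm, h] at hv
    norm_num at hv
  set c : Fin n → ℚ := VQ⁻¹ *ᵥ fun i => (w i : ℚ)
  have hwc : ∀ k, (w k : ℚ) = ∑ i, c i * (v.vec i k : ℚ) := by
    have h1 : VQ *ᵥ c = fun i => (w i : ℚ) := by
      rw [mulVec_mulVec, mul_nonsing_inv _ hVQ, one_mulVec]
    intro k
    rw [← congrFun h1 k]
    simp only [mulVec, dotProduct, VQ, of_apply]
    exact Finset.sum_congr rfl fun i _ => mul_comm _ _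
  have hr : realVec w = V *ᵥ fun i => (c i : ℝ) := by
    ext k
    have := congrArg (Rat.cast : ℚ → ℝ) (hwc k)
    push_cast at this
    simp only [realVec, this, mulVec, dotProduct, V, of_apply]
    exact Finset.sum_congr rfl fun i _ => mul_comm _ _
  rw [hr, mulVec_mulVec, nonsing_inv_mul _ hV, one_mulVec]
  obtain ⟨i, hi⟩ : ∃ i, 1 ≤ |c i| := by
    by_contra! h
    exact hc ⟨hw, c, fun i => ⟨abs_nonneg _, h i⟩, hwc⟩
  have hi' : (1 : ℝ) ≤ (c i : ℝ) ^ 2 := by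
    rw [← sq_abs]
    exact one_le_pow₀ (by exact_mod_cast hi)
  exact hi'.trans (Finset.single_le_sum (f := fun i => (c i : ℝ) ^ 2) (fun _ _ => sq_nonneg _)
    (Finset.mem_univ i))

end Voronoi

/-! ### The main argument. -/

open Matrix Voronoi in
theorem theorem3p9 (n : ℕ) (hn : n = 2 ∨ n = 3) (v : Voronoi.ModularSymbol n)
    (hv : 1 < v.norm) (σ : Voronoi.Cone n) (hσ : σ.IsTop) (hb : v.b ∈ σ.toSet) :
    (v.cand ∩ σ.vertices).Nonempty := by
  obtain ⟨A, m, hA, hm, hprim, hface⟩ := hσ.exists_form (by omega)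
  have hdetA := pow_mul_le_det hn hA hm fun w hw => le_of_forall_primitive_le hm.le hprim hw
  -- This makes the Minkowski constant `π² / 36` exceed `1 / 4`, matching `det(V)² ≥ 4`.
  have hpi : (9 : ℝ) < Real.pi ^ 2 := by nlinarith [Real.pi_gt_three]
  have hmn : 0 < m ^ n := pow_pos hm n
  have hdet4 : m ^ n < 4 * A.det := by nlinarith
  have hAp : A.PosDef := hA.posDef_iff_det_ne_zero.2 (by nlinarith)
  by_contra hempty
  have hnot : ∀ w : Fin n → ℤ, IsPrimitive w → realVec w ⬝ᵥ A *ᵥ realVec w = m → w ∉ v.cand := by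
    intro w hw hwm hc
    have hwF : q w ∈ σ.face := by
      rw [hface]
      exact ⟨q_mem_polyhedron hw, by rw [trace_mul_q, hwm]⟩
    refine hempty ⟨w, hc, hw, q_mem_extremePoints (A := A) (fun x hx => ?_) hm.ne' (fun x hx => ?_)
      hwF⟩
    · rw [hface] at hx; exact hx.1
    · rw [hface] at hx; exact hx.2
  have hV4 := ModularSymbol.four_le_det_sq hv
  have hb' := v.b_eq
  have hcand := fun w => ModularSymbol.one_le_of_notMem_cand hv (w := w)
  set V : Matrix (Fin n) (Fin n) ℝ := Matrix.of fun i j => (v.vec j i : ℝ)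
  have hV : IsUnit V.det := isUnit_iff_ne_zero.2 fun h => by
    rw [h] at hV4
    norm_num at hV4
  obtain ⟨t, ht, x, hx, hbt⟩ := hb
  rw [hface] at hx
  have hCx : 1 ≤ ((V⁻¹ᵀ * V⁻¹) * x).trace := by
    refine one_le_trace_mul_of_mem_face hAp hprim
      (by simpa using posSemidef_conjTranspose_mul_self V⁻¹) (fun w hw hwm => ?_) hx.1 hx.2
    rw [dotProduct_transpose_mul_self]
    refine hcand w ?_ (hnot w hw hwm)
    rintro rfl
    have : realVec (0 : Fin n → ℤ) = 0 := by ext; simp [realVec]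
    rw [this, zero_dotProduct] at hwm
    exact hm.ne hwm
  have hCb : ((V⁻¹ᵀ * V⁻¹) * v.b).trace = n := by
    rw [hb', Matrix.mul_assoc, nonsing_inv_mul_cancel_left _ _ hV, ← transpose_mul,
      mul_nonsing_inv _ hV]
    simp
  have htn : t ≤ n := by
    rw [hbt, Matrix.mul_smul, trace_smul, smul_eq_mul] at hCb
    nlinarith
  have hAb : (Vᵀ * A * V).trace = t * m := by
    rw [Matrix.mul_assoc, trace_mul_comm, Matrix.mul_assoc, ← hb', hbt, Matrix.mul_smul, trace_smul,
      hx.2, smul_eq_mul]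
  have hP : (Vᵀ * A * V).PosSemidef := by
    simpa using hA.conjTranspose_mul_mul_same V
  have hamgm := pow_card_mul_det_le_trace_pow hn hP
  rw [hAb, det_mul, det_mul, det_transpose, mul_pow] at hamgm
  have hnn : (0 : ℝ) < (n : ℝ) ^ n := by
    have : 0 < n := by omega
    positivity
  have htn' : t ^ n ≤ (n : ℝ) ^ n := pow_le_pow_left₀ ht htn n
  have h1 : m ^ n < V.det * A.det * V.det := by nlinarith
  have h2 := mul_lt_mul_of_pos_left h1 hnn
  have h3 := mul_le_mul_of_nonneg_right htn' hmn.le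
  linarith
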